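/- Let $0\le K\le N$ be integers and let $\mathcal U$ index the $\binom NK$ subsets $\mathcal S_i\subseteq\{1,\dots,N\}$ of size $K$ (the activation patterns). Fix channel gains $g_l\ge 0$, phases $\theta_l\in\mathbb R$ and powers $\rho_{li}\ge 0$ ($i\in\mathcal U$, $l\in\mathcal S_i$), and put $a_{li}=g_l\rho_{li}$. For a probability vector $\mathbf p=(p_i)_{i\in\mathcal U}$ and $\sigma^2>0$, let the pattern $U$ satisfy $\mathbb P(U=i)=p_i$. Given $U=i$, let the inputs $X_1,\dots,X_N$ be independent with $X_l\sim\mathcal{CN}(0,\rho_{li})$ for $l\in\mathcal S_i$ and $X_l=0$ for $l\notin\mathcal S_i$. Let $Y_l=\sqrt{g_l}\,e^{\mathsf j\theta_l}X_l+Z_l$, where $Z_1,\dots,Z_N\sim\mathcal{CN}(0,\sigma^2)$ are independent of each other and of $(U,\mathbf X)$. Let $I(\mathbf p,\boldsymbol\rho,\sigma^2)=I(\mathbf X;\mathbf Y)$ be the mutual information in nats, and let $I^\star(\boldsymbol\rho,\sigma^2)=\max_{\mathbf p}I(\mathbf p,\boldsymbol\rho,\sigma^2)$, the maximum being over all probability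 vectors on $\mathcal U$; the mutual information is finite and the maximum is attained. For each $\sigma^2>0$ let $i^\star=i^\star(\sigma^2)$ be a pattern that maximizes $\sum_{l\in\mathcal S_i}\ln\left(\frac{a_{li}}{\sigma^2}+1\right)$ over $i\in\mathcal U$, and let $\mathbf r$ be the point mass on $i^\star$, i.e. $r_{i^\star}=1$ and $r_i=0$ for $i\ne i^\star$. Then $\mathbf r$ maximizes the mutual information at low SNR, in the following sense: $$I(\mathbf r,\boldsymbol\rho,\sigma^2)\sim I^\star(\boldsymbol\rho,\sigma^2)\quad\text{as }\sigma^2\to\infty,$$ and if a single pattern has the strictly largest total received power $\sum_{l\in\mathcal S_i}a_{li}$, then $I(\mathbf r,\boldsymbol\rho,\sigma^2)=I^\star(\boldsymbol\rho,\sigma^2)$ for all sufficiently large $\sigma^2$. Moreover, $$I^\star(\boldsymbol\rho,\sigma^2)\sim\sum_{l\in\mathcal S_{i^\star}}\ln\left(\frac{a_{li^\star}}{\sigma^2}+1\right)\quad\text{as }\sigma^2\to\infty.$$ Here $u\sim v$ means $u-v=o(v)$. -/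

import Mathlib

open MeasureTheory ProbabilityTheory Filter Asymptotics

noncomputable section

namespace IndexModulation

/-- The subcarrier activation patterns: the `K`-element sets of active subcarriers among `N`.
The patterns themselves serve as index set, so the pattern with index `i` is `i.1`. -/
abbrev Pattern (N K : ℕ) : Type := {S : Finset (Fin N) // S.card = K}

/-- The circularly symmetric complex Gaussian law `CN(0, v)`: real and imaginary part are
independent real Gaussians with mean `0` and variance `v / 2` each
(for `v = 0`, the point mass at `0`). -/
def complexGaussian (v : ℝ) : Measure ℂ :=
  ((gaussianReal 0 (v / 2).toNNReal).prod (gaussianReal 0 (v / 2).toNNReal)).map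
    (fun t : ℝ × ℝ => (t.1 : ℂ) + (t.2 : ℂ) * Complex.I)

/-- The law of the input `X` conditioned on the pattern `i`: independent symbols, with
`X l` distributed as `CN(0, ρ l i)` on the active subcarriers and `X l = 0` on the others. -/
def inputLawGiven {N K : ℕ} (ρ : Fin N → Pattern N K → ℝ) (i : Pattern N K) :
    Measure (Fin N → ℂ) :=
  Measure.pi (fun l => if l ∈ i.1 then complexGaussian (ρ l i) else Measure.dirac 0)

/-- The law of the input `X` when pattern `i` is used with probability `p i`. -/
def inputLaw {N K : ℕ} (p : Pattern N K → ℝ) (ρ : Fin N → Pattern N K → ℝ) :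
    Measure (Fin N → ℂ) :=
  ∑ i, ENNReal.ofReal (p i) • inputLawGiven ρ i

/-- The law of the noise `Z`: independent `CN(0, σ²)` on each subcarrier; `v` stands for `σ²`. -/
def noiseLaw (N : ℕ) (v : ℝ) : Measure (Fin N → ℂ) :=
  Measure.pi (fun _ => complexGaussian v)

/-- The output of the parallel channel with coefficients `√(g l) * exp (j * θ l)`. -/
def channelOutput {N : ℕ} (g θ : Fin N → ℝ) (x z : Fin N → ℂ) : Fin N → ℂ :=
  fun l => (Real.sqrt (g l) : ℂ) * Complex.exp ((θ l : ℂ) * Complex.I) * x l + z l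

/-- The joint law of input and output `(X, Y)`, the noise being independent of the input. -/
def jointLaw {N K : ℕ} (g θ : Fin N → ℝ) (p : Pattern N K → ℝ)
    (ρ : Fin N → Pattern N K → ℝ) (v : ℝ) : Measure ((Fin N → ℂ) × (Fin N → ℂ)) :=
  ((inputLaw p ρ).prod (noiseLaw N v)).map (fun w => (w.1, channelOutput g θ w.1 w.2))

/-- The mutual information (in nats) of a pair with joint law `μ`: the Kullback-Leibler divergence
of the joint law from the product of its marginals, as an extended nonnegative number. -/
def mutualInfo {α β : Type*} [MeasurableSpace α] [MeasurableSpace β] (μ : Measure (α × β)) :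
    ENNReal :=
  InformationTheory.klDiv μ (μ.fst.prod μ.snd)

/-- `I(p, ρ, σ²) = I(X; Y)` as a real number; `v` stands for `σ²`. -/
def rate {N K : ℕ} (g θ : Fin N → ℝ) (p : Pattern N K → ℝ)
    (ρ : Fin N → Pattern N K → ℝ) (v : ℝ) : ℝ :=
  (mutualInfo (jointLaw g θ p ρ v)).toReal

/-- `I*(ρ, σ²)`: the supremum of `I(p, ρ, σ²)` over all probability vectors `p`. -/
def rateStar {N K : ℕ} (g θ : Fin N → ℝ) (ρ : Fin N → Pattern N K → ℝ) (v : ℝ) : ℝ :=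
  sSup ((fun p => rate g θ p ρ v) '' stdSimplex ℝ (Pattern N K))

/-- `∑ l ∈ S_i, ln (g_l ρ_{li} / σ² + 1)`. -/
def patternRate {N K : ℕ} (g : Fin N → ℝ) (ρ : Fin N → Pattern N K → ℝ) (v : ℝ)
    (i : Pattern N K) : ℝ :=
  ∑ l ∈ i.1, Real.log (g l * ρ l i / v + 1)

/-- The probability vector concentrated on the pattern `i`. -/
def pointMass {N K : ℕ} (i : Pattern N K) : Pattern N K → ℝ :=
  fun j => if j = i then 1 else 0

end IndexModulation

end

noncomputable section
namespace IndexModulation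

/-! Write `A i` for the total received power of pattern `i`, and take all output densities relative
to the noise law. The channel log-density has mean `A i / v` under pattern `i`, so the rate is `∑ p
i * A i / v` minus the divergence of the output law from the noise law (`mutualInfo_jointLaw`).

By Gibbs' inequality that divergence may be replaced by the mean log of any reference density
(`rate_le_of_density`). The constant density 1 gives the upper bound `M / v` with `M = max A i`.
Conversely a point mass achieves its pattern rate (`rate_pointMass`), which is at least `A / v - (A
/ v) ^ 2` (`le_patternRate`). All three functions of the theorem are squeezed between `M / v - (M /
v) ^ 2` and `M / v`, hence equivalent.

For exact optimality the reference is the output density of the strongest pattern `j`. The bound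
becomes the pattern rate of `j` plus a `p`-average of corrections which, multiplied by `v`, tend to
`A i - A j < 0` for `i ≠ j` (`eventually_rate_le_patternRate`).

The maximum is attained because the rate is continuous on the compact simplex (`continuousOn_rate`).
-/

theorem map_withDensity_comp {α β : Type*} [MeasurableSpace α] [MeasurableSpace β]
    (μ : Measure α) {f : α → β} (hf : Measurable f) {F : β → ENNReal} (hF : Measurable F) :
    (μ.withDensity (fun a => F (f a))).map f = (μ.map f).withDensity F := by
  ext s hs
  rw [Measure.map_apply hf hs, withDensity_apply _ (hf hs), withDensity_apply _ hs,
    setLIntegral_map hs hF hf]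

/-! ### Complex Gaussian laws: characteristic function, densities, moments -/

instance (v : ℝ) : IsProbabilityMeasure (complexGaussian v) :=
  Measure.isProbabilityMeasure_map (by fun_prop)

theorem complexGaussian_zero : complexGaussian 0 = Measure.dirac 0 := by
  unfold complexGaussian
  simp only [zero_div, Real.toNNReal_zero, gaussianReal_zero_var, Measure.dirac_prod_dirac]
  rw [Measure.map_dirac' (by fun_prop)]
  simp

theorem charFun_complexGaussian {v : ℝ} (hv : 0 ≤ v) (t : ℂ) :
    charFun (complexGaussian v) t = Complex.exp (-((v / 4 * ‖t‖ ^ 2 : ℝ) : ℂ)) := by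
  have h1 : ∀ s : ℝ, ∫ x : ℝ, Complex.exp ((x * s : ℝ) * Complex.I)
      ∂(gaussianReal 0 (v / 2).toNNReal) = Complex.exp (-((v / 4 * s ^ 2 : ℝ) : ℂ)) := by
    intro s
    have h := charFun_gaussianReal (μ := 0) (v := (v / 2).toNNReal) s
    rw [charFun_apply] at h
    have h2 : (((v / 2).toNNReal : ℝ) : ℂ) = v / 2 := by
      rw [Real.coe_toNNReal _ (by positivity)]; push_cast; rfl
    have h3 : ∀ x : ℝ, inner ℝ x s = x * s := fun x => by simp [mul_comm]
    simp only [h3] at h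
    rw [h, h2]
    congr 1
    push_cast
    ring
  rw [charFun_apply, complexGaussian, integral_map (by fun_prop) (by fun_prop)]
  have : ∀ z : ℝ × ℝ, Complex.exp ((inner ℝ ((z.1 : ℂ) + z.2 * Complex.I) t : ℝ) * Complex.I)
      = Complex.exp ((z.1 * t.re : ℝ) * Complex.I) * Complex.exp ((z.2 * t.im : ℝ) * Complex.I) := by
    intro z
    rw [← Complex.exp_add]
    congr 1
    rw [Complex.inner, ← add_mul, ← Complex.ofReal_add]
    congr 2
    simp
    ring
  simp only [this]
  rw [integral_prod_mul (fun x : ℝ => Complex.exp ((x * t.re : ℝ) * Complex.I))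
    (fun x : ℝ => Complex.exp ((x * t.im : ℝ) * Complex.I)), h1, h1, ← Complex.exp_add]
  congr 1
  rw [← Complex.normSq_eq_norm_sq, Complex.normSq_apply]
  push_cast
  ring

/-- Characteristic functions multiply, and the factor `c` moves to the frequency as `star c`, where
only its modulus matters: the channel phase disappears. Zero variances are allowed, so silent
subcarriers need no separate case. -/
theorem map_mul_add_complexGaussian (c : ℂ) {a v : ℝ} (ha : 0 ≤ a) (hv : 0 ≤ v) :
    ((complexGaussian a).prod (complexGaussian v)).map (fun w => c * w.1 + w.2)
      = complexGaussian (‖c‖ ^ 2 * a + v) := by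
  have : IsProbabilityMeasure
      (((complexGaussian a).prod (complexGaussian v)).map (fun w => c * w.1 + w.2)) :=
    Measure.isProbabilityMeasure_map (by fun_prop)
  apply Measure.ext_of_charFun
  funext t
  rw [charFun_complexGaussian (by positivity), charFun_apply,
    integral_map (by fun_prop) (by fun_prop)]
  have : ∀ w : ℂ × ℂ, Complex.exp ((inner ℝ (c * w.1 + w.2) t : ℝ) * Complex.I)
      = Complex.exp ((inner ℝ w.1 (star c * t) : ℝ) * Complex.I)
        * Complex.exp ((inner ℝ w.2 t : ℝ) * Complex.I) := by
    intro w
    rw [← Complex.exp_add]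
    congr 1
    rw [← add_mul, ← Complex.ofReal_add]
    congr 2
    simp only [Complex.inner]
    simp
    ring
  simp only [this]
  rw [integral_prod_mul (fun x : ℂ => Complex.exp ((inner ℝ x (star c * t) : ℝ) * Complex.I))
    (fun x : ℂ => Complex.exp ((inner ℝ x t : ℝ) * Complex.I)), ← charFun_apply, ← charFun_apply,
    charFun_complexGaussian ha, charFun_complexGaussian hv, ← Complex.exp_add, norm_mul, norm_star]
  congr 1
  push_cast
  ring

theorem complexGaussian_eq_withDensity_volume {v : ℝ} (hv : 0 < v) :
    complexGaussian v = (volume : Measure ℂ).withDensity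
      (fun y => ENNReal.ofReal ((Real.pi * v)⁻¹ * Real.exp (-‖y‖ ^ 2 / v))) := by
  have hne : (v / 2).toNNReal ≠ 0 := by simp [hv]
  have hF : Measurable (fun y : ℂ =>
      ENNReal.ofReal ((Real.pi * v)⁻¹ * Real.exp (-‖y‖ ^ 2 / v))) := by fun_prop
  have he : (fun t : ℝ × ℝ => (t.1 : ℂ) + (t.2 : ℂ) * Complex.I)
      = Complex.measurableEquivRealProd.symm := by
    funext t
    apply Complex.ext <;> simp [Complex.measurableEquivRealProd]
  rw [complexGaussian, gaussianReal_of_var_ne_zero _ hne,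
    prod_withDensity (measurable_gaussianPDF _ _) (measurable_gaussianPDF _ _), he,
    ← Complex.volume_preserving_equiv_real_prod.symm.map_eq,
    ← map_withDensity_comp _ (MeasurableEquiv.measurable _) hF, ← he]
  congr 2
  funext z
  simp only [gaussianPDF, gaussianPDFReal]
  rw [← ENNReal.ofReal_mul (by positivity), Real.coe_toNNReal _ (by positivity),
    ← Complex.normSq_eq_norm_sq, Complex.normSq_add_mul_I]
  congr 1
  have h1 : √(2 * Real.pi * (v / 2)) * √(2 * Real.pi * (v / 2)) = Real.pi * v := by
    rw [Real.mul_self_sqrt (by positivity)]; ring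
  calc _ = (√(2 * Real.pi * (v / 2)) * √(2 * Real.pi * (v / 2)))⁻¹ *
        (Real.exp (-(z.1 - 0) ^ 2 / (2 * (v / 2))) * Real.exp (-(z.2 - 0) ^ 2 / (2 * (v / 2)))) := by
        rw [mul_inv]; ring
    _ = _ := by
        rw [h1, ← Real.exp_add]
        congr 2
        field_simp
        ring

theorem complexGaussian_eq_withDensity {v w : ℝ} (hv : 0 < v) (hw : 0 < w) :
    complexGaussian w = (complexGaussian v).withDensity
      (fun y => ENNReal.ofReal (v / w * Real.exp (‖y‖ ^ 2 * (1 / v - 1 / w)))) := by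
  rw [complexGaussian_eq_withDensity_volume hv, complexGaussian_eq_withDensity_volume hw,
    ← withDensity_mul _ (by fun_prop) (by fun_prop)]
  congr 1
  funext y
  rw [Pi.mul_apply, ← ENNReal.ofReal_mul (by positivity)]
  congr 1
  have : Real.exp (-‖y‖ ^ 2 / w)
      = Real.exp (-‖y‖ ^ 2 / v) * Real.exp (‖y‖ ^ 2 * (1 / v - 1 / w)) := by
    rw [← Real.exp_add]; congr 1; ring
  rw [this]
  field_simp

/-- Cameron-Martin formula: Lebesgue measure is translation invariant, and expanding `‖y - m‖ ^ 2`
leaves the stated exponent. -/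
theorem map_add_left_complexGaussian {v : ℝ} (hv : 0 < v) (m : ℂ) :
    (complexGaussian v).map (fun z => m + z) = (complexGaussian v).withDensity
      (fun y => ENNReal.ofReal (Real.exp ((2 * (star m * y).re - ‖m‖ ^ 2) / v))) := by
  rw [complexGaussian_eq_withDensity_volume hv, ← withDensity_mul _ (by fun_prop) (by fun_prop)]
  have h := map_withDensity_comp (volume : Measure ℂ) (f := fun z : ℂ => m + z) (by fun_prop)
    (F := fun y => ENNReal.ofReal ((Real.pi * v)⁻¹ * Real.exp (-‖y - m‖ ^ 2 / v))) (by fun_prop)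
  simp only [add_sub_cancel_left] at h
  rw [h, map_add_left_eq_self]
  congr 1
  funext y
  rw [Pi.mul_apply, ← ENNReal.ofReal_mul (by positivity), mul_assoc, ← Real.exp_add]
  congr 3
  rw [← add_div]
  congr 1
  simp only [← Complex.normSq_eq_norm_sq, Complex.normSq_apply]
  simp
  ring

theorem integrable_sq_gaussianReal (v : NNReal) :
    Integrable (fun x : ℝ => x ^ 2) (gaussianReal 0 v) :=
  (memLp_id_gaussianReal (μ := 0) (v := v) 2).integrable_sq

theorem integrable_id_gaussianReal (v : NNReal) :
    Integrable (fun x : ℝ => x) (gaussianReal 0 v) :=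
  (memLp_id_gaussianReal (μ := 0) (v := v) 1).integrable (by simp)

theorem integral_sq_gaussianReal (v : NNReal) :
    ∫ x : ℝ, x ^ 2 ∂(gaussianReal 0 v) = v := by
  have h := variance_eq_sub (memLp_id_gaussianReal (μ := 0) (v := v) 2)
  rw [variance_id_gaussianReal] at h
  simpa using h.symm

theorem integrable_norm_sq_complexGaussian (v : ℝ) :
    Integrable (fun y : ℂ => ‖y‖ ^ 2) (complexGaussian v) := by
  rw [complexGaussian, integrable_map_measure (by fun_prop) (by fun_prop)]
  have : (fun y : ℂ => ‖y‖ ^ 2) ∘ (fun t : ℝ × ℝ => (t.1 : ℂ) + (t.2 : ℂ) * Complex.I)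
      = fun t => t.1 ^ 2 + t.2 ^ 2 := by
    funext t
    simp only [Function.comp]
    rw [← Complex.normSq_eq_norm_sq, Complex.normSq_add_mul_I]
  rw [this]
  exact ((integrable_sq_gaussianReal _).comp_fst _).add ((integrable_sq_gaussianReal _).comp_snd _)

theorem integral_norm_sq_complexGaussian {v : ℝ} (hv : 0 ≤ v) :
    ∫ y : ℂ, ‖y‖ ^ 2 ∂(complexGaussian v) = v := by
  rw [complexGaussian, integral_map (by fun_prop) (by fun_prop)]
  simp only [← Complex.normSq_eq_norm_sq, Complex.normSq_add_mul_I]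
  rw [integral_add ((integrable_sq_gaussianReal _).comp_fst _)
    ((integrable_sq_gaussianReal _).comp_snd _), integral_fun_fst (fun x : ℝ => x ^ 2),
    integral_fun_snd (fun x : ℝ => x ^ 2), integral_sq_gaussianReal,
    Real.coe_toNNReal _ (by positivity)]
  simp

theorem integrable_id_complexGaussian (v : ℝ) :
    Integrable (fun y : ℂ => y) (complexGaussian v) := by
  rw [complexGaussian, integrable_map_measure (by fun_prop) (by fun_prop)]
  exact ((integrable_id_gaussianReal _).comp_fst _).ofReal.add
    (((integrable_id_gaussianReal _).comp_snd _).ofReal.mul_const _)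

theorem integral_id_complexGaussian (v : ℝ) :
    ∫ y : ℂ, y ∂(complexGaussian v) = 0 := by
  rw [complexGaussian, integral_map (by fun_prop) (by fun_prop)]
  rw [integral_add (((integrable_id_gaussianReal _).comp_fst _).ofReal)
    (((integrable_id_gaussianReal _).comp_snd _).ofReal.mul_const _),
    integral_mul_const, integral_fun_fst (fun x : ℝ => (x : ℂ)),
    integral_fun_snd (fun x : ℝ => (x : ℂ)), integral_complex_ofReal]
  simp

theorem integrable_cross_complexGaussian (c : ℂ) (a v : ℝ) :
    Integrable (fun w : ℂ × ℂ => star (c * w.1) * w.2)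
      ((complexGaussian a).prod (complexGaussian v)) := by
  have h : Integrable (fun y : ℂ => star (c * y)) (complexGaussian a) :=
    (Complex.conjCLE : ℂ →L[ℝ] ℂ).integrable_comp ((integrable_id_complexGaussian a).const_mul c)
  exact h.mul_prod (integrable_id_complexGaussian v)

/-- At the output `c * x + z` the log-density is `‖c * x‖ ^ 2 / v` plus a cross term in `x` and `z`,
whose mean vanishes because the two are independent and centred. -/
theorem integrable_shiftLogDensity (c : ℂ) (a v : ℝ) :
    Integrable (fun w : ℂ × ℂ => (2 * (star (c * w.1) * (c * w.1 + w.2)).re - ‖c * w.1‖ ^ 2) / v)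
      ((complexGaussian a).prod (complexGaussian v)) ∧
    ∫ w : ℂ × ℂ, (2 * (star (c * w.1) * (c * w.1 + w.2)).re - ‖c * w.1‖ ^ 2) / v
      ∂((complexGaussian a).prod (complexGaussian v))
      = ‖c‖ ^ 2 * (∫ x, ‖x‖ ^ 2 ∂(complexGaussian a)) / v := by
  have e : ∀ w : ℂ × ℂ, (2 * (star (c * w.1) * (c * w.1 + w.2)).re - ‖c * w.1‖ ^ 2) / v
      = (‖c‖ ^ 2 * ‖w.1‖ ^ 2 + 2 * (star (c * w.1) * w.2).re) / v := by
    intro w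
    have : star (c * w.1) * (c * w.1 + w.2)
        = ((‖c * w.1‖ ^ 2 : ℝ) : ℂ) + star (c * w.1) * w.2 := by
      rw [mul_add]
      congr 1
      rw [← Complex.normSq_eq_norm_sq, Complex.normSq_eq_conj_mul_self]
      rfl
    rw [this, Complex.add_re, Complex.ofReal_re, norm_mul]
    ring
  simp only [e]
  have h1 : Integrable (fun w : ℂ × ℂ => ‖c‖ ^ 2 * ‖w.1‖ ^ 2)
      ((complexGaussian a).prod (complexGaussian v)) :=
    ((integrable_norm_sq_complexGaussian a).comp_fst _).const_mul _
  have hc := integrable_cross_complexGaussian c a v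
  have h2 : Integrable (fun w : ℂ × ℂ => 2 * (star (c * w.1) * w.2).re)
      ((complexGaussian a).prod (complexGaussian v)) := hc.re.const_mul _
  refine ⟨(h1.add h2).div_const _, ?_⟩
  have h0 : ∫ w : ℂ × ℂ, star (c * w.1) * w.2 ∂((complexGaussian a).prod (complexGaussian v)) = 0 := by
    rw [integral_prod_mul (fun x : ℂ => star (c * x)) (fun y : ℂ => y), integral_id_complexGaussian,
      mul_zero]
  have h3 : ∫ w : ℂ × ℂ, (star (c * w.1) * w.2).re
      ∂((complexGaussian a).prod (complexGaussian v)) = 0 := by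
    have := integral_re hc
    rw [h0] at this
    simpa using this
  rw [integral_div, integral_add h1 h2, integral_const_mul, integral_const_mul, h3,
    integral_fun_fst (fun x : ℂ => ‖x‖ ^ 2)]
  simp

/-! ### Densities of product and joint laws; divergence and mutual information -/

theorem pi_withDensity {ι : Type*} [Fintype ι] {Ω : ι → Type*} [∀ l, MeasurableSpace (Ω l)]
    (μ : ∀ l, Measure (Ω l)) [∀ l, IsProbabilityMeasure (μ l)] {f : ∀ l, Ω l → ENNReal}
    (hf : ∀ l, Measurable (f l)) [∀ l, SigmaFinite ((μ l).withDensity (f l))] :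
    Measure.pi (fun l => (μ l).withDensity (f l))
      = (Measure.pi μ).withDensity (fun y => ∏ l, f l (y l)) := by
  refine Measure.pi_eq (μ := fun l => (μ l).withDensity (f l)) fun s hs => ?_
  rw [withDensity_apply _ (MeasurableSet.univ_pi hs),
    ← lintegral_indicator (MeasurableSet.univ_pi hs)]
  have h : ∀ y : ∀ l, Ω l, (Set.univ.pi s).indicator (fun y => ∏ l, f l (y l)) y
      = ∏ l, (s l).indicator (f l) (y l) := by
    intro y
    by_cases hy : y ∈ Set.univ.pi s
    · rw [Set.indicator_of_mem hy]
      exact Finset.prod_congr rfl fun l _ => (Set.indicator_of_mem (hy l trivial) _).symm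
    · rw [Set.indicator_of_notMem hy]
      simp only [Set.mem_pi, Set.mem_univ, forall_true_left, not_forall] at hy
      obtain ⟨l, hl⟩ := hy
      exact (Finset.prod_eq_zero (Finset.mem_univ l) (Set.indicator_of_notMem hl _)).symm
  simp only [h]
  rw [lintegral_prod_eq_prod_lintegral_of_indepFun Finset.univ
    (fun l (y : ∀ l, Ω l) => (s l).indicator (f l) (y l))
    (iIndepFun_pi fun l => ((hf l).indicator (hs l)).aemeasurable)
    (fun l => ((hf l).indicator (hs l)).comp (measurable_pi_apply l))]
  refine Finset.prod_congr rfl fun l _ => ?_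
  rw [withDensity_apply _ (hs l), ← lintegral_indicator (hs l),
    ← (measurePreserving_eval μ l).lintegral_comp ((hf l).indicator (hs l))]

/-- Tonelli over the input: the density of the output given each `x` serves as the joint density. -/
theorem map_prodMk_eq_withDensity {α β : Type*} [MeasurableSpace α] [MeasurableSpace β]
    (P : Measure α) (Q : Measure β) [SFinite P] [SFinite Q] {S : α × β → β} (hS : Measurable S)
    {k : α × β → ENNReal} (hk : Measurable k)
    (h : ∀ x, Q.map (fun z => S (x, z)) = Q.withDensity (fun y => k (x, y))) :
    (P.prod Q).map (fun w => (w.1, S w)) = (P.prod Q).withDensity k := by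
  ext s hs
  have hm : Measurable (fun w : α × β => (w.1, S w)) := by fun_prop
  rw [Measure.map_apply hm hs, withDensity_apply _ hs, ← lintegral_indicator hs,
    Measure.prod_apply (hm hs), lintegral_prod _ (hk.indicator hs).aemeasurable]
  refine lintegral_congr fun x => ?_
  have hsx : MeasurableSet (Prod.mk x ⁻¹' s) := measurable_prodMk_left hs
  have := congrArg (fun m => m (Prod.mk x ⁻¹' s)) (h x)
  beta_reduce at this
  rw [Measure.map_apply (by fun_prop) hsx, withDensity_apply _ hsx,
    ← lintegral_indicator hsx] at this
  exact this

theorem klDiv_withDensity {α : Type*} [MeasurableSpace α] {μ ν : Measure α}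
    [IsProbabilityMeasure μ] [IsProbabilityMeasure ν] {φ : α → ℝ} (hφ : Measurable φ)
    (hpos : ∀ x, 0 < φ x) (h : μ = ν.withDensity (fun x => ENNReal.ofReal (φ x)))
    (hint : Integrable (fun x => Real.log (φ x)) μ) :
    InformationTheory.klDiv μ ν ≠ ⊤ ∧
      (InformationTheory.klDiv μ ν).toReal = ∫ x, Real.log (φ x) ∂μ := by
  have hac : μ ≪ ν := h ▸ withDensity_absolutelyContinuous _ _
  have hllr : llr μ ν =ᵐ[μ] fun x => Real.log (φ x) := by
    have h1 : μ.rnDeriv ν =ᵐ[ν] fun x => ENNReal.ofReal (φ x) := by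
      conv_lhs => rw [h]
      exact Measure.rnDeriv_withDensity ν (by fun_prop)
    filter_upwards [hac.ae_le h1] with x hx
    rw [llr_def]
    simp only [hx, ENNReal.toReal_ofReal (hpos x).le]
  refine ⟨InformationTheory.klDiv_ne_top hac (hint.congr hllr.symm), ?_⟩
  -- Both measures have mass one, so the mass correction in `klDiv` vanishes.
  rw [InformationTheory.toReal_klDiv_of_measure_eq hac (by simp), integral_congr_ae hllr]

/-- Relative to `J.fst.prod Q` the joint law has density `k` and the product of marginals has
density `f` in the second variable, so the log-likelihood ratio is `log k - log f`. The reference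
`Q` will be the noise law. -/
theorem mutualInfo_withDensity {α β : Type*} [MeasurableSpace α] [MeasurableSpace β]
    {J : Measure (α × β)} [IsProbabilityMeasure J] (Q : Measure β) [IsProbabilityMeasure Q]
    {k : α × β → ℝ} {f : β → ℝ} (hk : Measurable k) (hf : Measurable f)
    (hk0 : ∀ w, 0 < k w) (hf0 : ∀ y, 0 < f y)
    (hJ : J = (J.fst.prod Q).withDensity (fun w => ENNReal.ofReal (k w)))
    (hs : J.snd = Q.withDensity (fun y => ENNReal.ofReal (f y)))
    (hik : Integrable (fun w => Real.log (k w)) J)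
    (hif : Integrable (fun y => Real.log (f y)) J.snd) :
    mutualInfo J ≠ ⊤ ∧
      (mutualInfo J).toReal = ∫ w, Real.log (k w) ∂J - ∫ y, Real.log (f y) ∂J.snd := by
  have hif' : Integrable (fun w : α × β => Real.log (f w.2)) J := by
    rw [Measure.snd, integrable_map_measure hf.log.aestronglyMeasurable (by fun_prop)] at hif
    exact hif
  have hlog : ∀ w : α × β, Real.log (k w / f w.2) = Real.log (k w) - Real.log (f w.2) :=
    fun w => Real.log_div (hk0 w).ne' (hf0 w.2).ne'
  have key := klDiv_withDensity (μ := J) (ν := J.fst.prod J.snd) (φ := fun w => k w / f w.2)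
    (by fun_prop) (fun w => div_pos (hk0 w) (hf0 w.2)) ?_ ?_
  · refine ⟨key.1, ?_⟩
    rw [mutualInfo, key.2]
    simp only [hlog]
    rw [integral_sub hik hif', Measure.snd,
      integral_map (by fun_prop) hf.log.aestronglyMeasurable]
  · have hp : J.fst.prod J.snd
        = (J.fst.prod Q).withDensity (fun w => ENNReal.ofReal (f w.2)) := by
      rw [hs, prod_withDensity_right (by fun_prop)]
    rw [hp, ← withDensity_mul _ (by fun_prop) (by fun_prop)]
    conv_lhs => rw [hJ]
    congr 1
    funext w
    rw [Pi.mul_apply, ← ENNReal.ofReal_mul (hf0 _).le, mul_div_cancel₀ _ (hf0 _).ne']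
  · simp only [hlog]
    exact hik.sub hif'

/-- Gibbs' inequality for densities with respect to a common measure. -/
theorem integral_log_le_integral_log {β : Type*} [MeasurableSpace β] (Q : Measure β)
    {f r : β → ℝ} (hf : Measurable f) (hf0 : ∀ y, 0 < f y) (hr0 : ∀ y, 0 < r y)
    [IsProbabilityMeasure (Q.withDensity (fun y => ENNReal.ofReal (f y)))]
    (hr : Integrable r Q) (hr1 : ∫ y, r y ∂Q ≤ 1)
    (hlf : Integrable (fun y => Real.log (f y)) (Q.withDensity (fun y => ENNReal.ofReal (f y))))
    (hlr : Integrable (fun y => Real.log (r y)) (Q.withDensity (fun y => ENNReal.ofReal (f y)))) :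
    ∫ y, Real.log (r y) ∂(Q.withDensity (fun y => ENNReal.ofReal (f y)))
      ≤ ∫ y, Real.log (f y) ∂(Q.withDensity (fun y => ENNReal.ofReal (f y))) := by
  set P := Q.withDensity (fun y => ENNReal.ofReal (f y)) with hP
  have hsm : ∀ y, (ENNReal.ofReal (f y)).toReal • (r y / f y) = r y := fun y => by
    rw [ENNReal.toReal_ofReal (hf0 y).le, smul_eq_mul, mul_div_cancel₀ _ (hf0 y).ne']
  have hi : Integrable (fun y => r y / f y) P := by
    rw [hP, integrable_withDensity_iff_integrable_smul' (by fun_prop) (by simp)]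
    simpa only [hsm] using hr
  have he : ∫ y, r y / f y ∂P = ∫ y, r y ∂Q := by
    rw [hP, integral_withDensity_eq_integral_toReal_smul (by fun_prop) (by simp)]
    simp only [hsm]
  -- This is `log t ≤ t - 1` at `t = r / f`; the added term has integral `∫ r ∂Q - 1 ≤ 0`.
  have h1 : ∫ y, Real.log (r y) ∂P ≤ ∫ y, (Real.log (f y) + (r y / f y - 1)) ∂P := by
    refine integral_mono hlr (hlf.add (hi.sub (integrable_const 1))) fun y => ?_
    have := Real.log_le_sub_one_of_pos (div_pos (hr0 y) (hf0 y))
    rw [Real.log_div (hr0 y).ne' (hf0 y).ne'] at this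
    simp only
    linarith
  rw [integral_add hlf (g := fun y => r y / f y - 1) (hi.sub (integrable_const 1)),
    integral_sub hi (integrable_const 1), he] at h1
  simp at h1
  linarith

/-! ### The channel: input, output and joint laws with their densities -/

variable {N K : ℕ}

/-- The variance of the input on each subcarrier under the pattern `i`. -/
def inputPower (ρ : Fin N → Pattern N K → ℝ) (i : Pattern N K) (l : Fin N) : ℝ :=
  if l ∈ i.1 then ρ l i else 0

/-- The received power on each subcarrier under the pattern `i`. -/
def receivedPower (g : Fin N → ℝ) (ρ : Fin N → Pattern N K → ℝ) (i : Pattern N K) (l : Fin N) :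
    ℝ :=
  if l ∈ i.1 then g l * ρ l i else 0

/-- The law of the output conditioned on the pattern `i`. -/
def outputLawGiven (g : Fin N → ℝ) (ρ : Fin N → Pattern N K → ℝ) (v : ℝ) (i : Pattern N K) :
    Measure (Fin N → ℂ) :=
  Measure.pi (fun l => complexGaussian (receivedPower g ρ i l + v))

/-- The density of `outputLawGiven` with respect to the noise law. -/
def outputDensity (g : Fin N → ℝ) (ρ : Fin N → Pattern N K → ℝ) (v : ℝ) (i : Pattern N K)
    (y : Fin N → ℂ) : ℝ :=
  ∏ l, (v / (receivedPower g ρ i l + v)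
    * Real.exp (‖y l‖ ^ 2 * (1 / v - 1 / (receivedPower g ρ i l + v))))

/-- The channel coefficient `√(g l) * exp (j * θ l)`. -/
def channelCoeff (g θ : Fin N → ℝ) (l : Fin N) : ℂ :=
  (Real.sqrt (g l) : ℂ) * Complex.exp ((θ l : ℂ) * Complex.I)

/-- The density of the joint law with respect to the product of input law and noise law. -/
def transitionDensity (g θ : Fin N → ℝ) (v : ℝ) (w : (Fin N → ℂ) × (Fin N → ℂ)) : ℝ :=
  ∏ l, Real.exp ((2 * (star (channelCoeff g θ l * w.1 l) * w.2 l).re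
    - ‖channelCoeff g θ l * w.1 l‖ ^ 2) / v)

/-- The density of the output law with respect to the noise law. -/
def mixtureDensity (g : Fin N → ℝ) (p : Pattern N K → ℝ) (ρ : Fin N → Pattern N K → ℝ) (v : ℝ)
    (y : Fin N → ℂ) : ℝ :=
  ∑ i, p i * outputDensity g ρ v i y

variable {g θ : Fin N → ℝ} {ρ : Fin N → Pattern N K → ℝ} {p : Pattern N K → ℝ} {v : ℝ}

theorem norm_channelCoeff_sq (hg : ∀ l, 0 ≤ g l) (l : Fin N) : ‖channelCoeff g θ l‖ ^ 2 = g l := by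
  rw [channelCoeff, norm_mul, Complex.norm_exp_ofReal_mul_I, mul_one, Complex.norm_real,
    Real.norm_eq_abs, sq_abs, Real.sq_sqrt (hg l)]

theorem inputPower_nonneg (hρ : ∀ i : Pattern N K, ∀ l ∈ i.1, 0 ≤ ρ l i) (i : Pattern N K)
    (l : Fin N) : 0 ≤ inputPower ρ i l := by
  unfold inputPower
  split_ifs with h
  · exact hρ i l h
  · exact le_rfl

theorem mul_inputPower (i : Pattern N K) (l : Fin N) :
    g l * inputPower ρ i l = receivedPower g ρ i l := by
  unfold inputPower receivedPower
  split_ifs <;> simp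

theorem receivedPower_nonneg (hg : ∀ l, 0 ≤ g l) (hρ : ∀ i : Pattern N K, ∀ l ∈ i.1, 0 ≤ ρ l i)
    (i : Pattern N K) (l : Fin N) : 0 ≤ receivedPower g ρ i l := by
  rw [← mul_inputPower]
  exact mul_nonneg (hg l) (inputPower_nonneg hρ i l)

/-- Silent subcarriers contribute `F 0 = 0`. Used for the total power and for the pattern rate. -/
theorem sum_receivedPower (F : ℝ → ℝ) (hF : F 0 = 0) (i : Pattern N K) :
    ∑ l, F (receivedPower g ρ i l) = ∑ l ∈ i.1, F (g l * ρ l i) := by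
  rw [← Finset.sum_subset (Finset.subset_univ i.1)]
  · exact Finset.sum_congr rfl fun l hl => by rw [receivedPower, if_pos hl]
  · intro l _ hl
    rw [receivedPower, if_neg hl, hF]

/-- The point mass at 0 is the Gaussian of variance 0, which treats all subcarriers uniformly. -/
theorem inputLawGiven_eq (ρ : Fin N → Pattern N K → ℝ) (i : Pattern N K) :
    inputLawGiven ρ i = Measure.pi (fun l => complexGaussian (inputPower ρ i l)) := by
  unfold inputLawGiven inputPower
  congr 1
  funext l
  split_ifs
  · rfl
  · exact complexGaussian_zero.symm

instance (i : Pattern N K) : IsProbabilityMeasure (inputLawGiven ρ i) := by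
  rw [inputLawGiven_eq]; infer_instance

instance : IsProbabilityMeasure (noiseLaw N v) := by
  unfold noiseLaw; infer_instance

instance (i : Pattern N K) : IsProbabilityMeasure (outputLawGiven g ρ v i) := by
  unfold outputLawGiven; infer_instance

theorem isProbabilityMeasure_mixture {ι α : Type*} [Fintype ι] [MeasurableSpace α]
    {p : ι → ℝ} (hp : p ∈ stdSimplex ℝ ι) (μ : ι → Measure α) [∀ i, IsProbabilityMeasure (μ i)] :
    IsProbabilityMeasure (∑ i, ENNReal.ofReal (p i) • μ i) := by
  constructor
  simp only [Measure.coe_finsetSum, Finset.sum_apply, Measure.smul_apply, measure_univ,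
    smul_eq_mul, mul_one]
  rw [← ENNReal.ofReal_sum_of_nonneg fun i _ => hp.1 i, hp.2, ENNReal.ofReal_one]

theorem isProbabilityMeasure_inputLaw (hp : p ∈ stdSimplex ℝ (Pattern N K)) :
    IsProbabilityMeasure (inputLaw p ρ) :=
  isProbabilityMeasure_mixture hp _

theorem measurable_channelOutput (g θ : Fin N → ℝ) :
    Measurable (fun w : (Fin N → ℂ) × (Fin N → ℂ) => channelOutput g θ w.1 w.2) := by
  unfold channelOutput
  fun_prop

/-- Regrouping the pair of vectors as a vector of pairs makes the channel act coordinatewise on a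
product measure. -/
theorem map_channelOutput (hg : ∀ l, 0 ≤ g l) (hρ : ∀ i : Pattern N K, ∀ l ∈ i.1, 0 ≤ ρ l i)
    (hv : 0 < v) (i : Pattern N K) :
    ((inputLawGiven ρ i).prod (noiseLaw N v)).map (fun w => channelOutput g θ w.1 w.2)
      = outputLawGiven g ρ v i := by
  rw [inputLawGiven_eq, noiseLaw, ← (measurePreserving_arrowProdEquivProdArrow ℂ ℂ (Fin N)
    (fun l => complexGaussian (inputPower ρ i l)) (fun _ => complexGaussian v)).map_eq,
    Measure.map_map (measurable_channelOutput g θ) (MeasurableEquiv.measurable _)]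
  have h : ((fun w : (Fin N → ℂ) × (Fin N → ℂ) => channelOutput g θ w.1 w.2) ∘
      MeasurableEquiv.arrowProdEquivProdArrow ℂ ℂ (Fin N))
      = fun u l => channelCoeff g θ l * (u l).1 + (u l).2 := rfl
  have h1 : ∀ l, ((complexGaussian (inputPower ρ i l)).prod (complexGaussian v)).map
      (fun w => channelCoeff g θ l * w.1 + w.2) = complexGaussian (receivedPower g ρ i l + v) := by
    intro l
    rw [map_mul_add_complexGaussian _ (inputPower_nonneg hρ i l) hv.le, norm_channelCoeff_sq hg,
      mul_inputPower]
  have hsf : ∀ l, SigmaFinite (((complexGaussian (inputPower ρ i l)).prod (complexGaussian v)).map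
      (fun w => channelCoeff g θ l * w.1 + w.2)) := by
    intro l; rw [h1]; infer_instance
  rw [h, Measure.pi_map_pi (f := fun l (w : ℂ × ℂ) => channelCoeff g θ l * w.1 + w.2)
    (fun l => by fun_prop), outputLawGiven]
  simp only [h1]

theorem outputDensity_pos (hg : ∀ l, 0 ≤ g l) (hρ : ∀ i : Pattern N K, ∀ l ∈ i.1, 0 ≤ ρ l i)
    (hv : 0 < v) (i : Pattern N K) (y : Fin N → ℂ) : 0 < outputDensity g ρ v i y := by
  refine Finset.prod_pos fun l _ => ?_
  have := receivedPower_nonneg hg hρ i l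
  positivity

@[fun_prop]
theorem measurable_outputDensity (i : Pattern N K) : Measurable (outputDensity g ρ v i) := by
  unfold outputDensity
  fun_prop

theorem outputLawGiven_eq_withDensity (hg : ∀ l, 0 ≤ g l)
    (hρ : ∀ i : Pattern N K, ∀ l ∈ i.1, 0 ≤ ρ l i) (hv : 0 < v) (i : Pattern N K) :
    outputLawGiven g ρ v i
      = (noiseLaw N v).withDensity (fun y => ENNReal.ofReal (outputDensity g ρ v i y)) := by
  have hA := receivedPower_nonneg hg hρ i
  have h1 : ∀ l, complexGaussian (receivedPower g ρ i l + v) = _ := fun l =>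
    complexGaussian_eq_withDensity hv (add_pos_of_nonneg_of_pos (hA l) hv)
  have hsf : ∀ l, SigmaFinite ((complexGaussian v).withDensity
      (fun y => ENNReal.ofReal (v / (receivedPower g ρ i l + v)
        * Real.exp (‖y‖ ^ 2 * (1 / v - 1 / (receivedPower g ρ i l + v)))))) := by
    intro l; rw [← h1]; infer_instance
  unfold outputLawGiven noiseLaw outputDensity
  simp only [h1]
  rw [pi_withDensity (μ := fun _ : Fin N => complexGaussian v) (f := fun l y =>
    ENNReal.ofReal (v / (receivedPower g ρ i l + v)
        * Real.exp (‖y‖ ^ 2 * (1 / v - 1 / (receivedPower g ρ i l + v))))) (fun l => by fun_prop)]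
  congr 1
  funext y
  rw [ENNReal.ofReal_prod_of_nonneg]
  intro l _
  have := hA l
  positivity

theorem transitionDensity_pos (w : (Fin N → ℂ) × (Fin N → ℂ)) : 0 < transitionDensity g θ v w :=
  Finset.prod_pos fun _ _ => Real.exp_pos _

theorem measurable_transitionDensity : Measurable (transitionDensity g θ v) := by
  unfold transitionDensity
  fun_prop

theorem map_channelOutput_noise (hv : 0 < v) (x : Fin N → ℂ) :
    (noiseLaw N v).map (fun z => channelOutput g θ x z)
      = (noiseLaw N v).withDensity (fun y => ENNReal.ofReal (transitionDensity g θ v (x, y))) := by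
  have h1 := fun l => map_add_left_complexGaussian hv (channelCoeff g θ l * x l)
  have hsf : ∀ l, SigmaFinite ((complexGaussian v).map (fun z => channelCoeff g θ l * x l + z)) :=
    fun l => by
      have := Measure.isProbabilityMeasure_map (μ := complexGaussian v)
        (f := fun z => channelCoeff g θ l * x l + z) (by fun_prop)
      infer_instance
  have hsf' : ∀ l, SigmaFinite ((complexGaussian v).withDensity
      (fun y => ENNReal.ofReal (Real.exp ((2 * (star (channelCoeff g θ l * x l) * y).re
        - ‖channelCoeff g θ l * x l‖ ^ 2) / v)))) := by
    intro l; rw [← h1]; exact hsf l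
  unfold noiseLaw
  have h : (fun z => channelOutput g θ x z) = fun z l => channelCoeff g θ l * x l + z l := rfl
  rw [h, Measure.pi_map_pi (f := fun l (z : ℂ) => channelCoeff g θ l * x l + z)
    (fun l => by fun_prop)]
  simp only [h1]
  rw [pi_withDensity (μ := fun _ : Fin N => complexGaussian v) (f := fun l y =>
      ENNReal.ofReal (Real.exp ((2 * (star (channelCoeff g θ l * x l) * y).re
        - ‖channelCoeff g θ l * x l‖ ^ 2) / v))) (fun l => by fun_prop)]
  congr 1
  funext y
  rw [transitionDensity, ENNReal.ofReal_prod_of_nonneg fun l _ => (Real.exp_pos _).le]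

theorem isProbabilityMeasure_jointLaw (hp : p ∈ stdSimplex ℝ (Pattern N K)) :
    IsProbabilityMeasure (jointLaw g θ p ρ v) := by
  have := isProbabilityMeasure_inputLaw (ρ := ρ) hp
  exact Measure.isProbabilityMeasure_map
    (measurable_fst.prodMk (measurable_channelOutput g θ)).aemeasurable

theorem jointLaw_fst (p : Pattern N K → ℝ) : (jointLaw g θ p ρ v).fst = inputLaw p ρ := by
  have : SFinite (inputLaw p ρ) := by
    unfold inputLaw
    rw [← Measure.sum_fintype]
    infer_instance
  rw [jointLaw, Measure.fst, Measure.map_map measurable_fst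
    (measurable_fst.prodMk (measurable_channelOutput g θ))]
  change Measure.map Prod.fst _ = _
  rw [Measure.map_fst_prod]
  simp

theorem jointLaw_eq_withDensity (hv : 0 < v) (hp : p ∈ stdSimplex ℝ (Pattern N K)) :
    jointLaw g θ p ρ v = ((inputLaw p ρ).prod (noiseLaw N v)).withDensity
      (fun w => ENNReal.ofReal (transitionDensity g θ v w)) := by
  have := isProbabilityMeasure_inputLaw (ρ := ρ) hp
  exact map_prodMk_eq_withDensity _ _ (measurable_channelOutput g θ)
    measurable_transitionDensity.ennreal_ofReal (map_channelOutput_noise hv)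

theorem inputLaw_prod (p : Pattern N K → ℝ) :
    (inputLaw p ρ).prod (noiseLaw N v)
      = ∑ i, ENNReal.ofReal (p i) • (inputLawGiven ρ i).prod (noiseLaw N v) := by
  rw [inputLaw, ← Measure.sum_fintype, Measure.prod_sum_left, Measure.sum_fintype]
  simp only [Measure.prod_smul_left]

theorem jointLaw_snd (hg : ∀ l, 0 ≤ g l) (hρ : ∀ i : Pattern N K, ∀ l ∈ i.1, 0 ≤ ρ l i)
    (hv : 0 < v) (p : Pattern N K → ℝ) :
    (jointLaw g θ p ρ v).snd = ∑ i, ENNReal.ofReal (p i) • outputLawGiven g ρ v i := by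
  rw [jointLaw, Measure.snd, Measure.map_map measurable_snd
    (measurable_fst.prodMk (measurable_channelOutput g θ))]
  change Measure.map (fun w : (Fin N → ℂ) × (Fin N → ℂ) => channelOutput g θ w.1 w.2) _ = _
  rw [inputLaw_prod, Measure.map_finset_sum (measurable_channelOutput g θ).aemeasurable]
  simp only [Measure.map_smul, map_channelOutput hg hρ hv]

theorem measurable_mixtureDensity : Measurable (mixtureDensity g p ρ v) := by
  unfold mixtureDensity
  fun_prop

theorem mixtureDensity_pos (hg : ∀ l, 0 ≤ g l) (hρ : ∀ i : Pattern N K, ∀ l ∈ i.1, 0 ≤ ρ l i)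
    (hv : 0 < v) (hp : p ∈ stdSimplex ℝ (Pattern N K)) (y : Fin N → ℂ) :
    0 < mixtureDensity g p ρ v y := by
  have h0 : ∀ i ∈ Finset.univ, 0 ≤ p i * outputDensity g ρ v i y := fun i _ =>
    mul_nonneg (hp.1 i) (outputDensity_pos hg hρ hv i y).le
  refine lt_of_le_of_ne (Finset.sum_nonneg h0) fun h => ?_
  have h1 := (Finset.sum_eq_zero_iff_of_nonneg h0).1 h.symm
  have h2 : ∑ i, p i = 0 := Finset.sum_eq_zero fun i hi =>
    (mul_eq_zero.1 (h1 i hi)).resolve_right (outputDensity_pos hg hρ hv i y).ne'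
  rw [hp.2] at h2
  exact one_ne_zero h2

theorem sum_outputLawGiven_eq_withDensity (hg : ∀ l, 0 ≤ g l)
    (hρ : ∀ i : Pattern N K, ∀ l ∈ i.1, 0 ≤ ρ l i) (hv : 0 < v)
    (hp : p ∈ stdSimplex ℝ (Pattern N K)) :
    ∑ i, ENNReal.ofReal (p i) • outputLawGiven g ρ v i
      = (noiseLaw N v).withDensity (fun y => ENNReal.ofReal (mixtureDensity g p ρ v y)) := by
  ext s hs
  simp only [outputLawGiven_eq_withDensity hg hρ hv]
  rw [withDensity_apply _ hs]
  simp only [Measure.coe_finsetSum, Finset.sum_apply, Measure.smul_apply, smul_eq_mul,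
    withDensity_apply _ hs, mixtureDensity]
  have : ∀ y, ENNReal.ofReal (∑ i, p i * outputDensity g ρ v i y)
      = ∑ i, ENNReal.ofReal (p i) * ENNReal.ofReal (outputDensity g ρ v i y) := by
    intro y
    rw [ENNReal.ofReal_sum_of_nonneg fun i _ =>
      mul_nonneg (hp.1 i) (outputDensity_pos hg hρ hv i y).le]
    exact Finset.sum_congr rfl fun i _ => ENNReal.ofReal_mul (hp.1 i)
  simp only [this]
  rw [lintegral_finsetSum _ fun i _ => by fun_prop]
  refine Finset.sum_congr rfl fun i _ => ?_
  rw [lintegral_const_mul _ (by fun_prop)]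

/-! ### Means of log-densities -/

theorem integrable_sum_comp_eval {ι : Type*} [Fintype ι] {Ω : ι → Type*}
    [∀ l, MeasurableSpace (Ω l)] (μ : ∀ l, Measure (Ω l)) [∀ l, IsProbabilityMeasure (μ l)]
    {F : ∀ l, Ω l → ℝ} (hF : ∀ l, Integrable (F l) (μ l)) :
    Integrable (fun y => ∑ l, F l (y l)) (Measure.pi μ) ∧
      ∫ y, ∑ l, F l (y l) ∂(Measure.pi μ) = ∑ l, ∫ x, F l x ∂(μ l) := by
  have hi : ∀ l ∈ Finset.univ, Integrable (fun y => F l (y l)) (Measure.pi μ) := fun l _ =>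
    (measurePreserving_eval μ l).integrable_comp_of_integrable (hF l)
  refine ⟨integrable_finsetSum _ hi, ?_⟩
  rw [integral_finsetSum _ hi]
  refine Finset.sum_congr rfl fun l _ => ?_
  have hl := (measurePreserving_eval μ l).map_eq
  have hF' := (hF l).aestronglyMeasurable
  conv_rhs => rw [← hl]
  rw [← hl] at hF'
  rw [integral_map (measurable_pi_apply l).aemeasurable hF']

theorem integrable_mixture {ι α : Type*} [Fintype ι] [MeasurableSpace α] {p : ι → ℝ}
    (hp : p ∈ stdSimplex ℝ ι) {μ : ι → Measure α} {F : α → ℝ} (hF : ∀ i, Integrable F (μ i)) :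
    Integrable F (∑ i, ENNReal.ofReal (p i) • μ i) ∧
      ∫ x, F x ∂(∑ i, ENNReal.ofReal (p i) • μ i) = ∑ i, p i * ∫ x, F x ∂(μ i) := by
  have hi : ∀ i ∈ Finset.univ, Integrable F (ENNReal.ofReal (p i) • μ i) := fun i _ =>
    (hF i).smul_measure ENNReal.ofReal_ne_top
  refine ⟨integrable_finsetSum_measure.2 hi, ?_⟩
  rw [integral_finsetSum_measure hi]
  refine Finset.sum_congr rfl fun i _ => ?_
  rw [integral_smul_measure, ENNReal.toReal_ofReal (hp.1 i), smul_eq_mul]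

/-- The logarithm is affine in the `‖y l‖ ^ 2`, so only second moments under pattern `i` enter. -/
theorem integrable_log_outputDensity (hg : ∀ l, 0 ≤ g l)
    (hρ : ∀ i : Pattern N K, ∀ l ∈ i.1, 0 ≤ ρ l i) (hv : 0 < v) (j i : Pattern N K) :
    Integrable (fun y => Real.log (outputDensity g ρ v j y)) (outputLawGiven g ρ v i) ∧
      ∫ y, Real.log (outputDensity g ρ v j y) ∂(outputLawGiven g ρ v i)
        = ∑ l, (Real.log (v / (receivedPower g ρ j l + v)) + (receivedPower g ρ i l + v)
          * (1 / v - 1 / (receivedPower g ρ j l + v))) := by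
  have hA := receivedPower_nonneg hg hρ
  have hlog : ∀ y, Real.log (outputDensity g ρ v j y)
      = ∑ l, (Real.log (v / (receivedPower g ρ j l + v))
        + ‖y l‖ ^ 2 * (1 / v - 1 / (receivedPower g ρ j l + v))) := by
    intro y
    have h0 : ∀ l, v / (receivedPower g ρ j l + v) ≠ 0 := fun l => by
      have := hA j l
      positivity
    rw [outputDensity, Real.log_prod fun l _ => mul_ne_zero (h0 l) (Real.exp_pos _).ne']
    exact Finset.sum_congr rfl fun l _ => by
      rw [Real.log_mul (h0 l) (Real.exp_pos _).ne', Real.log_exp]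
  simp only [hlog]
  have hF : ∀ l, Integrable (fun x : ℂ => Real.log (v / (receivedPower g ρ j l + v))
      + ‖x‖ ^ 2 * (1 / v - 1 / (receivedPower g ρ j l + v)))
      (complexGaussian (receivedPower g ρ i l + v)) := fun l =>
    (integrable_const _).add ((integrable_norm_sq_complexGaussian _).mul_const _)
  have key := integrable_sum_comp_eval
    (fun l => complexGaussian (receivedPower g ρ i l + v)) hF
  refine ⟨key.1, key.2.trans (Finset.sum_congr rfl fun l _ => ?_)⟩
  rw [integral_add (integrable_const _) ((integrable_norm_sq_complexGaussian _).mul_const _),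
    integral_mul_const, integral_norm_sq_complexGaussian (add_nonneg (hA i l) hv.le)]
  simp

theorem integrable_log_transitionDensity (hg : ∀ l, 0 ≤ g l)
    (hρ : ∀ i : Pattern N K, ∀ l ∈ i.1, 0 ≤ ρ l i) (i : Pattern N K) :
    Integrable (fun w : (Fin N → ℂ) × (Fin N → ℂ) =>
        Real.log (transitionDensity g θ v (w.1, channelOutput g θ w.1 w.2)))
      ((inputLawGiven ρ i).prod (noiseLaw N v)) ∧
      ∫ w : (Fin N → ℂ) × (Fin N → ℂ),
        Real.log (transitionDensity g θ v (w.1, channelOutput g θ w.1 w.2))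
        ∂((inputLawGiven ρ i).prod (noiseLaw N v)) = (∑ l, receivedPower g ρ i l) / v := by
  have hmp := measurePreserving_arrowProdEquivProdArrow ℂ ℂ (Fin N)
    (fun l => complexGaussian (inputPower ρ i l)) (fun _ => complexGaussian v)
  have hlog : ∀ w : (Fin N → ℂ) × (Fin N → ℂ),
      Real.log (transitionDensity g θ v (w.1, channelOutput g θ w.1 w.2))
      = ∑ l, (2 * (star (channelCoeff g θ l * w.1 l)
          * (channelCoeff g θ l * w.1 l + w.2 l)).re - ‖channelCoeff g θ l * w.1 l‖ ^ 2) / v := by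
    intro w
    rw [transitionDensity, Real.log_prod fun l _ => (Real.exp_pos _).ne']
    simp only [Real.log_exp]
    rfl
  have key := integrable_sum_comp_eval
    (fun l => (complexGaussian (inputPower ρ i l)).prod (complexGaussian v))
    (fun l => (integrable_shiftLogDensity (channelCoeff g θ l) (inputPower ρ i l) v).1)
  rw [inputLawGiven_eq, noiseLaw]
  simp only [hlog]
  refine ⟨(hmp.integrable_comp_emb (MeasurableEquiv.measurableEmbedding _)).1 key.1, ?_⟩
  rw [← hmp.integral_comp (MeasurableEquiv.measurableEmbedding _)]
  refine key.2.trans ?_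
  rw [Finset.sum_div]
  refine Finset.sum_congr rfl fun l _ => ?_
  rw [(integrable_shiftLogDensity _ _ _).2, norm_channelCoeff_sq hg,
    integral_norm_sq_complexGaussian (inputPower_nonneg hρ i l), mul_inputPower]

/-- A convex combination of numbers in `[exp (-B), exp B]` stays there. The bound does not depend on
`p`, which dominated convergence needs later. -/
theorem abs_log_mixtureDensity_le (hg : ∀ l, 0 ≤ g l)
    (hρ : ∀ i : Pattern N K, ∀ l ∈ i.1, 0 ≤ ρ l i) (hv : 0 < v)
    (hp : p ∈ stdSimplex ℝ (Pattern N K)) (y : Fin N → ℂ) :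
    |Real.log (mixtureDensity g p ρ v y)| ≤ ∑ i, |Real.log (outputDensity g ρ v i y)| := by
  set B := ∑ i, |Real.log (outputDensity g ρ v i y)| with hB
  have hle : ∀ i, |Real.log (outputDensity g ρ v i y)| ≤ B := fun i =>
    Finset.single_le_sum (f := fun i => |Real.log (outputDensity g ρ v i y)|)
      (fun _ _ => abs_nonneg _) (Finset.mem_univ i)
  have hsum : ∀ c : ℝ, ∑ i, p i * c = c := fun c => by rw [← Finset.sum_mul, hp.2, one_mul]
  have hm := mixtureDensity_pos hg hρ hv hp y
  rw [abs_le]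
  constructor
  · rw [Real.le_log_iff_exp_le hm, ← hsum (Real.exp (-B))]
    refine Finset.sum_le_sum fun i _ => mul_le_mul_of_nonneg_left ?_ (hp.1 i)
    rw [← Real.le_log_iff_exp_le (outputDensity_pos hg hρ hv i y)]
    exact (abs_le.1 (hle i)).1
  · rw [Real.log_le_iff_le_exp hm, ← hsum (Real.exp B)]
    refine Finset.sum_le_sum fun i _ => mul_le_mul_of_nonneg_left ?_ (hp.1 i)
    rw [← Real.log_le_iff_le_exp (outputDensity_pos hg hρ hv i y)]
    exact (abs_le.1 (hle i)).2

theorem integrable_log_mixtureDensity (hg : ∀ l, 0 ≤ g l)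
    (hρ : ∀ i : Pattern N K, ∀ l ∈ i.1, 0 ≤ ρ l i) (hv : 0 < v)
    (hp : p ∈ stdSimplex ℝ (Pattern N K)) :
    Integrable (fun y => Real.log (mixtureDensity g p ρ v y))
      (∑ i, ENNReal.ofReal (p i) • outputLawGiven g ρ v i) := by
  refine (integrable_mixture hp fun i => ?_).1
  refine Integrable.mono' (integrable_finsetSum Finset.univ fun j _ =>
    (integrable_log_outputDensity hg hρ hv j i).1.abs)
    measurable_mixtureDensity.log.aestronglyMeasurable (ae_of_all _ fun y => ?_)
  rw [Real.norm_eq_abs]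
  exact abs_log_mixtureDensity_le hg hρ hv hp y

/-! ### The rate formula and bounds on the rate -/

theorem mutualInfo_jointLaw (hg : ∀ l, 0 ≤ g l)
    (hρ : ∀ i : Pattern N K, ∀ l ∈ i.1, 0 ≤ ρ l i) (hv : 0 < v)
    (hp : p ∈ stdSimplex ℝ (Pattern N K)) :
    mutualInfo (jointLaw g θ p ρ v) ≠ ⊤ ∧
      rate g θ p ρ v = ∑ i, p i * ((∑ l, receivedPower g ρ i l) / v)
        - ∫ y, Real.log (mixtureDensity g p ρ v y)
          ∂(∑ i, ENNReal.ofReal (p i) • outputLawGiven g ρ v i) := by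
  have := isProbabilityMeasure_jointLaw (g := g) (θ := θ) (ρ := ρ) (v := v) hp
  have hS : Measurable (fun w : (Fin N → ℂ) × (Fin N → ℂ) => (w.1, channelOutput g θ w.1 w.2)) :=
    measurable_fst.prodMk (measurable_channelOutput g θ)
  have hk := measurable_transitionDensity (g := g) (θ := θ) (v := v)
  have hmix := integrable_mixture hp
    (fun i => (integrable_log_transitionDensity (θ := θ) (v := v) hg hρ i).1)
  have hik : Integrable (fun w => Real.log (transitionDensity g θ v w)) (jointLaw g θ p ρ v) := by
    rw [jointLaw, integrable_map_measure hk.log.aestronglyMeasurable hS.aemeasurable, inputLaw_prod]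
    exact hmix.1
  have hik' : ∫ w, Real.log (transitionDensity g θ v w) ∂(jointLaw g θ p ρ v)
      = ∑ i, p i * ((∑ l, receivedPower g ρ i l) / v) := by
    rw [jointLaw, integral_map hS.aemeasurable hk.log.aestronglyMeasurable, inputLaw_prod, hmix.2]
    simp only [(integrable_log_transitionDensity hg hρ _).2]
  have hsnd := jointLaw_snd (θ := θ) hg hρ hv p
  have key := mutualInfo_withDensity (J := jointLaw g θ p ρ v) (noiseLaw N v) hk
    (measurable_mixtureDensity (g := g) (p := p) (ρ := ρ) (v := v)) transitionDensity_pos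
    (mixtureDensity_pos hg hρ hv hp) (by rw [jointLaw_fst]; exact jointLaw_eq_withDensity hv hp)
    (hsnd.trans (sum_outputLawGiven_eq_withDensity hg hρ hv hp)) hik
    (by rw [hsnd]; exact integrable_log_mixtureDensity hg hρ hv hp)
  refine ⟨key.1, ?_⟩
  rw [rate, key.2, hik', hsnd]

/-- An upper bound on the rate from any reference density `r`. -/
theorem rate_le_of_density (hg : ∀ l, 0 ≤ g l)
    (hρ : ∀ i : Pattern N K, ∀ l ∈ i.1, 0 ≤ ρ l i) (hv : 0 < v)
    (hp : p ∈ stdSimplex ℝ (Pattern N K)) {r : (Fin N → ℂ) → ℝ} (hr0 : ∀ y, 0 < r y)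
    (hr : Integrable r (noiseLaw N v)) (hr1 : ∫ y, r y ∂(noiseLaw N v) ≤ 1)
    (hlr : ∀ i, Integrable (fun y => Real.log (r y)) (outputLawGiven g ρ v i)) :
    rate g θ p ρ v ≤ ∑ i, p i * ((∑ l, receivedPower g ρ i l) / v
        - ∫ y, Real.log (r y) ∂(outputLawGiven g ρ v i)) := by
  have hmix := integrable_mixture hp hlr
  have hprob := isProbabilityMeasure_mixture hp (outputLawGiven g ρ v)
  have hlf := integrable_log_mixtureDensity hg hρ hv hp
  have hd := sum_outputLawGiven_eq_withDensity hg hρ hv hp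
  have hlr' := hmix.1
  rw [(mutualInfo_jointLaw hg hρ hv hp).2]
  simp only [mul_sub]
  rw [Finset.sum_sub_distrib, ← hmix.2]
  rw [hd] at hprob hlf hlr' ⊢
  have := integral_log_le_integral_log (noiseLaw N v) measurable_mixtureDensity
    (mixtureDensity_pos hg hρ hv hp) hr0 hr hr1 hlf hlr'
  linarith

theorem rate_le_sum_receivedPower (hg : ∀ l, 0 ≤ g l)
    (hρ : ∀ i : Pattern N K, ∀ l ∈ i.1, 0 ≤ ρ l i) (hv : 0 < v)
    (hp : p ∈ stdSimplex ℝ (Pattern N K)) :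
    rate g θ p ρ v ≤ ∑ i, p i * ((∑ l, receivedPower g ρ i l) / v) := by
  simpa using rate_le_of_density (θ := θ) hg hρ hv hp (r := fun _ => 1) (fun _ => one_pos)
    (integrable_const _) (by simp) (fun i => by simp)

/-- The reference density is the output density of pattern `j`, which has integral one against the
noise law. -/
theorem rate_le_of_pattern (hg : ∀ l, 0 ≤ g l)
    (hρ : ∀ i : Pattern N K, ∀ l ∈ i.1, 0 ≤ ρ l i) (hv : 0 < v)
    (hp : p ∈ stdSimplex ℝ (Pattern N K)) (j : Pattern N K) :
    rate g θ p ρ v ≤ ∑ i, p i * ((∑ l, receivedPower g ρ i l) / v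
        - ∑ l, (Real.log (v / (receivedPower g ρ j l + v)) + (receivedPower g ρ i l + v)
          * (1 / v - 1 / (receivedPower g ρ j l + v)))) := by
  have h1 : ∫⁻ y, ENNReal.ofReal (outputDensity g ρ v j y) ∂(noiseLaw N v) = 1 := by
    rw [← setLIntegral_univ, ← withDensity_apply _ MeasurableSet.univ,
      ← outputLawGiven_eq_withDensity hg hρ hv, measure_univ]
  have h0 : ∀ y, 0 ≤ outputDensity g ρ v j y := fun y => (outputDensity_pos hg hρ hv j y).le
  have hm : AEStronglyMeasurable (outputDensity g ρ v j) (noiseLaw N v) :=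
    (measurable_outputDensity j).aestronglyMeasurable
  have hi : Integrable (outputDensity g ρ v j) (noiseLaw N v) := by
    refine ⟨hm, ?_⟩
    rw [hasFiniteIntegral_iff_ofReal (ae_of_all _ h0), h1]
    exact ENNReal.one_lt_top
  have := rate_le_of_density (θ := θ) hg hρ hv hp (outputDensity_pos hg hρ hv j) hi
    (by rw [integral_eq_lintegral_of_nonneg_ae (ae_of_all _ h0) hm, h1]; simp)
    (fun i => (integrable_log_outputDensity hg hρ hv j i).1)
  simpa only [(integrable_log_outputDensity hg hρ hv j _).2] using this

theorem pointMass_mem_stdSimplex (i : Pattern N K) : pointMass i ∈ stdSimplex ℝ (Pattern N K) := by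
  constructor
  · intro j
    unfold pointMass
    split_ifs <;> simp
  · simp [pointMass]

theorem sum_pointMass_mul (i : Pattern N K) (F : Pattern N K → ℝ) :
    ∑ j, pointMass i j * F j = F i := by
  simp [pointMass]

theorem patternRate_eq (hv : v ≠ 0) (i : Pattern N K) :
    patternRate g ρ v i = ∑ l, Real.log ((receivedPower g ρ i l + v) / v) := by
  rw [patternRate, ← sum_receivedPower (fun a => Real.log (a / v + 1)) (by simp)]
  exact Finset.sum_congr rfl fun l _ => by rw [add_div, div_self hv]

theorem rate_pointMass (hg : ∀ l, 0 ≤ g l)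
    (hρ : ∀ i : Pattern N K, ∀ l ∈ i.1, 0 ≤ ρ l i) (hv : 0 < v) (i : Pattern N K) :
    rate g θ (pointMass i) ρ v = patternRate g ρ v i := by
  have hlaw : ∑ j, ENNReal.ofReal (pointMass i j) • outputLawGiven g ρ v j
      = outputLawGiven g ρ v i := by
    rw [Finset.sum_eq_single i (fun j _ hj => by simp [pointMass, hj]) (by simp)]
    simp [pointMass]
  have hdens : ∀ y, mixtureDensity g (pointMass i) ρ v y = outputDensity g ρ v i y := fun y =>
    sum_pointMass_mul i fun j => outputDensity g ρ v j y
  rw [(mutualInfo_jointLaw hg hρ hv (pointMass_mem_stdSimplex i)).2, sum_pointMass_mul, hlaw,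
    patternRate_eq hv.ne']
  simp only [hdens]
  rw [(integrable_log_outputDensity hg hρ hv i i).2, Finset.sum_div, ← Finset.sum_sub_distrib]
  refine Finset.sum_congr rfl fun l _ => ?_
  have hA := receivedPower_nonneg hg hρ i l
  have hne : receivedPower g ρ i l + v ≠ 0 := by positivity
  rw [Real.log_div hv.ne' hne, Real.log_div hne hv.ne']
  field_simp
  ring

/-! ### Attainment of the maximum -/

/-- Over the fixed noise law the rate is a linear term minus the integral of `f * log f`, with `f`
the mixture density; dominated convergence applies. -/
theorem continuousOn_rate (hg : ∀ l, 0 ≤ g l)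
    (hρ : ∀ i : Pattern N K, ∀ l ∈ i.1, 0 ≤ ρ l i) (hv : 0 < v) :
    ContinuousOn (fun p => rate g θ p ρ v) (stdSimplex ℝ (Pattern N K)) := by
  have heq : ∀ p ∈ stdSimplex ℝ (Pattern N K), rate g θ p ρ v
      = ∑ i, p i * ((∑ l, receivedPower g ρ i l) / v)
        - ∫ y, mixtureDensity g p ρ v y * Real.log (mixtureDensity g p ρ v y) ∂(noiseLaw N v) := by
    intro p hp
    rw [(mutualInfo_jointLaw hg hρ hv hp).2, sum_outputLawGiven_eq_withDensity hg hρ hv hp,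
      integral_withDensity_eq_integral_toReal_smul measurable_mixtureDensity.ennreal_ofReal
        (ae_of_all _ fun _ => ENNReal.ofReal_lt_top)]
    simp only [ENNReal.toReal_ofReal (mixtureDensity_pos hg hρ hv hp _).le, smul_eq_mul]
  refine ContinuousOn.congr ?_ heq
  refine ContinuousOn.sub (by fun_prop) ?_
  refine continuousOn_of_dominated
    -- Each weight is at most one, so the mixture is at most the sum of all densities.
    (bound := fun y => ∑ j, outputDensity g ρ v j y * ∑ i, |Real.log (outputDensity g ρ v i y)|)
    (fun p _ => (measurable_mixtureDensity.mul
      measurable_mixtureDensity.log).aestronglyMeasurable) ?_ ?_ ?_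
  · intro p hp
    refine ae_of_all _ fun y => ?_
    rw [norm_mul, Real.norm_eq_abs, Real.norm_eq_abs,
      abs_of_pos (mixtureDensity_pos hg hρ hv hp y), ← Finset.sum_mul]
    refine mul_le_mul ?_ (abs_log_mixtureDensity_le hg hρ hv hp y) (abs_nonneg _)
      (Finset.sum_nonneg fun i _ => (outputDensity_pos hg hρ hv i y).le)
    refine Finset.sum_le_sum fun i _ =>
      mul_le_of_le_one_left (outputDensity_pos hg hρ hv i y).le ?_
    rw [← hp.2]
    exact Finset.single_le_sum (fun j _ => hp.1 j) (Finset.mem_univ i)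
  · refine integrable_finsetSum _ fun j _ => ?_
    have h := integrable_finsetSum Finset.univ fun i _ =>
      (integrable_log_outputDensity hg hρ hv i j).1.abs
    rw [outputLawGiven_eq_withDensity hg hρ hv,
      integrable_withDensity_iff_integrable_smul' (by fun_prop)
        (ae_of_all _ fun _ => ENNReal.ofReal_lt_top)] at h
    simpa only [ENNReal.toReal_ofReal (outputDensity_pos hg hρ hv j _).le, smul_eq_mul] using h
  · refine ae_of_all _ fun y => Continuous.continuousOn ?_
    unfold mixtureDensity
    exact Real.continuous_mul_log.comp (by fun_prop)

theorem isGreatest_rateStar (hg : ∀ l, 0 ≤ g l)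
    (hρ : ∀ i : Pattern N K, ∀ l ∈ i.1, 0 ≤ ρ l i) (hv : 0 < v) (i : Pattern N K) :
    IsGreatest ((fun p => rate g θ p ρ v) '' stdSimplex ℝ (Pattern N K)) (rateStar g θ ρ v) :=
  ((isCompact_stdSimplex ℝ _).image_of_continuousOn (continuousOn_rate hg hρ hv)).isGreatest_sSup
    ⟨_, pointMass i, pointMass_mem_stdSimplex i, rfl⟩

theorem patternRate_le_rateStar (hg : ∀ l, 0 ≤ g l)
    (hρ : ∀ i : Pattern N K, ∀ l ∈ i.1, 0 ≤ ρ l i) (hv : 0 < v) (i : Pattern N K) :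
    patternRate g ρ v i ≤ rateStar g θ ρ v := by
  rw [← rate_pointMass (θ := θ) hg hρ hv]
  exact (isGreatest_rateStar hg hρ hv i).2 ⟨_, pointMass_mem_stdSimplex i, rfl⟩

/-! ### Low-SNR bounds and asymptotics -/

theorem rateStar_le (hg : ∀ l, 0 ≤ g l)
    (hρ : ∀ i : Pattern N K, ∀ l ∈ i.1, 0 ≤ ρ l i) (hv : 0 < v) (j : Pattern N K)
    (hj : ∀ i, ∑ l, receivedPower g ρ i l ≤ ∑ l, receivedPower g ρ j l) :
    rateStar g θ ρ v ≤ (∑ l, receivedPower g ρ j l) / v := by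
  obtain ⟨p, hp, h⟩ := (isGreatest_rateStar (θ := θ) hg hρ hv j).1
  rw [← h]
  refine (rate_le_sum_receivedPower hg hρ hv hp).trans ?_
  rw [← one_mul ((∑ l, receivedPower g ρ j l) / v), ← hp.2, Finset.sum_mul]
  exact Finset.sum_le_sum fun i _ => mul_le_mul_of_nonneg_left
    (div_le_div_of_nonneg_right (hj i) hv.le) (hp.1 i)

/-- With `x = a / v` on each subcarrier, `log (1 + x) ≥ x / (1 + x) ≥ x - x ^ 2`, and the sum of
squares of nonnegative terms is at most the square of the sum. -/
theorem le_patternRate (hg : ∀ l, 0 ≤ g l)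
    (hρ : ∀ i : Pattern N K, ∀ l ∈ i.1, 0 ≤ ρ l i) (hv : 0 < v) (i : Pattern N K) :
    (∑ l, receivedPower g ρ i l) / v - ((∑ l, receivedPower g ρ i l) / v) ^ 2
      ≤ patternRate g ρ v i := by
  have hA := receivedPower_nonneg hg hρ i
  have h1 : ∑ l, (receivedPower g ρ i l / v) ^ 2 ≤ (∑ l, receivedPower g ρ i l / v) ^ 2 :=
    Finset.sum_sq_le_sq_sum_of_nonneg fun l _ => div_nonneg (hA l) hv.le
  rw [patternRate_eq hv.ne', Finset.sum_div]
  calc _ ≤ ∑ l, receivedPower g ρ i l / v - ∑ l, (receivedPower g ρ i l / v) ^ 2 := by linarith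
    _ = ∑ l, (receivedPower g ρ i l / v - (receivedPower g ρ i l / v) ^ 2) :=
        (Finset.sum_sub_distrib _ _).symm
    _ ≤ _ := Finset.sum_le_sum fun l _ => ?_
  have h0 : 0 < receivedPower g ρ i l + v := add_pos_of_nonneg_of_pos (hA l) hv
  refine le_trans ?_ (Real.one_sub_inv_le_log_of_pos (div_pos h0 hv))
  rw [inv_div, ← sub_nonneg]
  have : 1 - v / (receivedPower g ρ i l + v)
      - (receivedPower g ρ i l / v - (receivedPower g ρ i l / v) ^ 2)
      = receivedPower g ρ i l ^ 3 / (v ^ 2 * (receivedPower g ρ i l + v)) := by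
    field_simp
    ring
  rw [this]
  have := hA l
  positivity

/-- The error `(M / v) ^ 2` is at most `c * (M / v)` once `v ≥ M / c`. The case `M = 0` is included,
as all received powers may vanish. -/
theorem isEquivalent_div_atTop_of_bounds {M : ℝ} {u : ℝ → ℝ}
    (h : ∀ v, 0 < v → M / v - (M / v) ^ 2 ≤ u v ∧ u v ≤ M / v) (hM : 0 ≤ M) :
    u ~[atTop] fun v => M / v := by
  refine isLittleO_iff.2 fun c hc => ?_
  filter_upwards [eventually_gt_atTop 0, eventually_ge_atTop (M / c)] with v hv hvc
  have hMv : 0 ≤ M / v := by positivity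
  have h1 : M / v ≤ c := by
    rw [div_le_iff₀ hv]
    rwa [div_le_iff₀ hc, mul_comm] at hvc
  rw [Pi.sub_apply, Real.norm_eq_abs, Real.norm_eq_abs, abs_of_nonneg hMv, abs_le]
  obtain ⟨h2, h3⟩ := h v hv
  have h4 : (M / v) ^ 2 ≤ c * (M / v) := by
    rw [sq]; exact mul_le_mul_of_nonneg_right h1 hMv
  have h5 : 0 ≤ c * (M / v) := by positivity
  constructor <;> linarith

theorem eventually_rate_le_patternRate (hg : ∀ l, 0 ≤ g l)
    (hρ : ∀ i : Pattern N K, ∀ l ∈ i.1, 0 ≤ ρ l i) (j : Pattern N K)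
    (hj : ∀ i, i ≠ j → ∑ l, receivedPower g ρ i l < ∑ l, receivedPower g ρ j l) :
    ∀ᶠ v : ℝ in atTop, ∀ p ∈ stdSimplex ℝ (Pattern N K),
      rate g θ p ρ v ≤ patternRate g ρ v j := by
  have hA := receivedPower_nonneg hg hρ
  -- The sum is the excess of the bound for pattern `i` over the pattern rate of `j`. It tends to 0,
  -- so its sign is read off after multiplication by `v`, when the limit is the strictly negative
  -- power difference.
  have hev : ∀ᶠ v : ℝ in atTop, ∀ i : Pattern N K,
      ∑ l, (receivedPower g ρ i l - receivedPower g ρ j l) / (receivedPower g ρ j l + v) ≤ 0 := by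
    refine eventually_all.2 fun i => ?_
    by_cases hij : i = j
    · simp [hij]
    have hlim : Tendsto (fun v : ℝ => ∑ l, (receivedPower g ρ i l - receivedPower g ρ j l)
        * (1 - receivedPower g ρ j l / (receivedPower g ρ j l + v))) atTop
        (nhds (∑ l, (receivedPower g ρ i l - receivedPower g ρ j l) * (1 - 0))) := by
      refine tendsto_finsetSum _ fun l _ => Tendsto.const_mul _ (Tendsto.const_sub _ ?_)
      exact Tendsto.div_atTop tendsto_const_nhds (tendsto_atTop_add_const_left _ _ tendsto_id)
    have hneg : ∑ l, (receivedPower g ρ i l - receivedPower g ρ j l) * (1 - 0) < 0 := by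
      simp only [sub_zero, mul_one, Finset.sum_sub_distrib]
      linarith [hj i hij]
    filter_upwards [hlim.eventually_lt_const hneg, eventually_gt_atTop 0] with v h hv
    have he : ∑ l, (receivedPower g ρ i l - receivedPower g ρ j l)
        * (1 - receivedPower g ρ j l / (receivedPower g ρ j l + v))
        = v * ∑ l, (receivedPower g ρ i l - receivedPower g ρ j l)
          / (receivedPower g ρ j l + v) := by
      rw [Finset.mul_sum]
      refine Finset.sum_congr rfl fun l _ => ?_
      have : receivedPower g ρ j l + v ≠ 0 := (add_pos_of_nonneg_of_pos (hA j l) hv).ne'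
      field_simp
      ring
    rw [he] at h
    exact (neg_of_mul_neg_right h hv.le).le
  filter_upwards [hev, eventually_gt_atTop 0] with v h hv p hp
  refine (rate_le_of_pattern hg hρ hv hp j).trans ?_
  have hone : patternRate g ρ v j = ∑ i, p i * patternRate g ρ v j := by
    rw [← Finset.sum_mul, hp.2, one_mul]
  rw [hone]
  refine Finset.sum_le_sum fun i _ => mul_le_mul_of_nonneg_left ?_ (hp.1 i)
  rw [← sub_nonpos]
  -- The logarithms cancel, leaving exactly the sum controlled by `hev`.
  refine le_trans (le_of_eq ?_) (h i)
  rw [patternRate_eq hv.ne', Finset.sum_div, ← Finset.sum_sub_distrib, ← Finset.sum_sub_distrib]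
  refine Finset.sum_congr rfl fun l _ => ?_
  have hne : receivedPower g ρ j l + v ≠ 0 := (add_pos_of_nonneg_of_pos (hA j l) hv).ne'
  rw [Real.log_div hv.ne' hne, Real.log_div hne hv.ne']
  field_simp
  ring

end IndexModulation
end

theorem proposition7 (N K : ℕ) (hK : K ≤ N)
    (g θ : Fin N → ℝ) (hg : ∀ l, 0 ≤ g l)
    (ρ : Fin N → IndexModulation.Pattern N K → ℝ)
    (hρ : ∀ i : IndexModulation.Pattern N K, ∀ l ∈ i.1, 0 ≤ ρ l i)
    (istar : ℝ → IndexModulation.Pattern N K)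
    (hstar : ∀ v : ℝ, 0 < v → ∀ i : IndexModulation.Pattern N K,
      IndexModulation.patternRate g ρ v i ≤ IndexModulation.patternRate g ρ v (istar v)) :
    -- the mutual information is finite, and `I*` is a maximum over the probability vectors
    (∀ v : ℝ, 0 < v →
      (∀ p ∈ stdSimplex ℝ (IndexModulation.Pattern N K),
        IndexModulation.mutualInfo (IndexModulation.jointLaw g θ p ρ v) ≠ ⊤) ∧
      IsGreatest ((fun p => IndexModulation.rate g θ p ρ v) ''
        stdSimplex ℝ (IndexModulation.Pattern N K)) (IndexModulation.rateStar g θ ρ v)) ∧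
    -- the point mass on `i*` is asymptotically optimal
    ((fun v : ℝ => IndexModulation.rate g θ (IndexModulation.pointMass (istar v)) ρ v)
      ~[atTop] (fun v : ℝ => IndexModulation.rateStar g θ ρ v)) ∧
    -- and exactly optimal at low SNR when one pattern has the largest total received power
    (∀ i₀ : IndexModulation.Pattern N K,
      (∀ i, i ≠ i₀ → ∑ l ∈ i.1, g l * ρ l i < ∑ l ∈ i₀.1, g l * ρ l i₀) →
      ∀ᶠ v : ℝ in atTop, IsMaxOn (fun p => IndexModulation.rate g θ p ρ v)
        (stdSimplex ℝ (IndexModulation.Pattern N K))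
        (IndexModulation.pointMass (istar v))) ∧
    -- the asymptotic equivalence of `I*` as `σ² → ∞`
    ((fun v : ℝ => IndexModulation.rateStar g θ ρ v)
      ~[atTop] (fun v : ℝ => ∑ l ∈ (istar v).1,
        Real.log (g l * ρ l (istar v) / v + 1))) := by
  have hsum : ∀ i, ∑ l, IndexModulation.receivedPower g ρ i l = ∑ l ∈ i.1, g l * ρ l i :=
    fun i => IndexModulation.sum_receivedPower (fun a => a) rfl i
  have : Nonempty (IndexModulation.Pattern N K) := ⟨istar 0⟩
  -- The pattern `j` is independent of `v`, unlike `istar v`; its power is the common constant `M`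
  -- of the three squeezes.
  obtain ⟨j, hj⟩ := Finite.exists_max fun i => ∑ l, IndexModulation.receivedPower g ρ i l
  have hM : 0 ≤ ∑ l, IndexModulation.receivedPower g ρ j l :=
    Finset.sum_nonneg fun l _ => IndexModulation.receivedPower_nonneg hg hρ j l
  have hlow := fun v (hv : 0 < v) =>
    (IndexModulation.le_patternRate hg hρ hv j).trans (hstar v hv j)
  have hle := fun v (hv : 0 < v) =>
    IndexModulation.patternRate_le_rateStar (θ := θ) hg hρ hv (istar v)
  have hup := fun v (hv : 0 < v) => IndexModulation.rateStar_le (θ := θ) hg hρ hv j hj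
  have hrate : (fun v : ℝ => IndexModulation.rate g θ (IndexModulation.pointMass (istar v)) ρ v)
      ~[atTop] fun v => (∑ l, IndexModulation.receivedPower g ρ j l) / v :=
    IndexModulation.isEquivalent_div_atTop_of_bounds (fun v hv => by
      rw [IndexModulation.rate_pointMass hg hρ hv]
      exact ⟨hlow v hv, (hle v hv).trans (hup v hv)⟩) hM
  have hpattern : (fun v : ℝ => IndexModulation.patternRate g ρ v (istar v))
      ~[atTop] fun v => (∑ l, IndexModulation.receivedPower g ρ j l) / v :=
    IndexModulation.isEquivalent_div_atTop_of_bounds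
      (fun v hv => ⟨hlow v hv, (hle v hv).trans (hup v hv)⟩) hM
  have hrateStar : (fun v : ℝ => IndexModulation.rateStar g θ ρ v)
      ~[atTop] fun v => (∑ l, IndexModulation.receivedPower g ρ j l) / v :=
    IndexModulation.isEquivalent_div_atTop_of_bounds
      (fun v hv => ⟨(hlow v hv).trans (hle v hv), hup v hv⟩) hM
  refine ⟨fun v hv => ⟨fun p hp => (IndexModulation.mutualInfo_jointLaw hg hρ hv hp).1,
    IndexModulation.isGreatest_rateStar hg hρ hv j⟩, hrate.trans hrateStar.symm, fun i₀ hi₀ => ?_,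
    hrateStar.trans hpattern.symm⟩
  simp only [← hsum] at hi₀
  filter_upwards [IndexModulation.eventually_rate_le_patternRate (θ := θ) hg hρ i₀ hi₀,
    eventually_gt_atTop 0] with v h hv
  -- There is no need to identify `istar v` with `i₀`: its pattern rate is at least as large.
  refine isMaxOn_iff.2 fun p hp => (h p hp).trans ?_
  rw [IndexModulation.rate_pointMass hg hρ hv]
  exact hstar v hv i₀
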